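/- Let $N\ge 1$, let $\beta_1,\dots,\beta_N>1$ be real, let $\omega_1,\dots,\omega_N\in\mathbb C$ be distinct with $|\omega_j|=1$, and put $A=\mathrm{diag}(\beta_1\omega_1,\dots,\beta_N\omega_N)$, $B=(1,\dots,1)^{T}\in\mathbb C^{N}$. Write $'$ for the conjugate transpose. Let $\mathbf S_0$ be uniformly distributed on $\big((0,1)\times(0,1)\big)^N\subset\mathbb C^N$ and let $Z_1,Z_2,\dots$ be i.i.d. $\mathcal{CN}(0,1)$, independent of $\mathbf S_0$. Consider the system $$\mathbf S_{i}=A\mathbf S_{i-1}+BY_{i-1}\ (i\ge 1),\qquad Y_0=0,\qquad Y_i=X_i+Z_i\ (i\ge1).$$ A full-state controller is a sequence of measurable maps with $X_i=\pi_i(\mathbf S_i)$; it is separated if $X_i=\sum_{j=1}^N\pi_{ji}(\mathbf S_i(j))$ with measurable $\pi_{ji}:\mathbb C\to\mathbb C$. It is stabilizing if $\limsup_{n\to\infty}\mathbb E|\mathbf S_n(j)|^2<\infty$ for all $j$. The asymptotic power of a controller is $\bar P=\lim_{n\to\infty}\frac1n\sum_{i=1}^n\mathbb E|X_i|^2$.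 A controller is called optimal in a class if it belongs to the class, is stabilizing, has a finite asymptotic power $\bar P$, and every stabilizing controller of the class satisfies $\liminf_{n\to\infty}\frac1n\sum_{i=1}^n\mathbb E|X_i|^2\ge\bar P$. Then the discrete algebraic Riccati equation $$G=A'GA-A'GB(B'GB+1)^{-1}B'GA$$ has exactly one Hermitian positive definite solution $G$. With $$C=(B'GB+1)^{-1}B'GA,$$ the stationary linear controller $X_i=-C\mathbf S_i$ is optimal among the separated controllers, and it is also optimal among all full-state controllers. It is the only stationary linear controller that is optimal among the separated controllers, and every controller that is optimal among the separated controllers satisfies $\lim_{n\to\infty}\frac1n\sum_{i=1}^n\mathbb E|X_i+C\mathbf S_i|^2=0$ along its own trajectory. -/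

import Mathlib

open MeasureTheory ProbabilityTheory Filter Topology
open scoped Matrix ENNReal NNReal ComplexOrder

noncomputable section

namespace LTIControl

/-- The diagonal system matrix with entries `β j * w j`. -/
def systemMatrix {N : ℕ} (β : Fin N → ℝ) (w : Fin N → ℂ) : Matrix (Fin N) (Fin N) ℂ :=
  Matrix.diagonal fun j => (β j : ℂ) * w j

/-- The all-ones input column. -/
def inputMatrix (N : ℕ) : Matrix (Fin N) (Fin 1) ℂ := fun _ _ => 1

/-- The circularly symmetric complex Gaussian law with mean zero and unit variance: the real and
imaginary parts are independent, each with variance one half. -/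
def stdComplexGaussian : Measure ℂ :=
  ((gaussianReal 0 (1 / 2)).prod (gaussianReal 0 (1 / 2))).map Complex.measurableEquivRealProd.symm

/-- The product of `N` copies of the open unit square of the complex plane. -/
def messageBox (N : ℕ) : Set (Fin N → ℂ) :=
  Set.pi Set.univ fun _ => Set.Ioo (0 : ℝ) 1 ×ℂ Set.Ioo (0 : ℝ) 1

/-- The message vector `M` is uniform on the unit box, the noise `Z` is i.i.d. standard complex
Gaussian, and the two are independent. -/
structure IsChannelModel {N : ℕ} {Ω : Type*} [MeasurableSpace Ω] (P : Measure Ω)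
    (M : Ω → Fin N → ℂ) (Z : ℕ → Ω → ℂ) : Prop where
  measurable_message : Measurable M
  measurable_noise : ∀ i, Measurable (Z i)
  message_uniform : P.map M = ProbabilityTheory.cond volume (messageBox N)
  noise_law : ∀ i, P.map (Z i) = stdComplexGaussian
  noise_indep : iIndepFun Z P
  message_noise_indep : IndepFun M (fun x i => Z i x) P

/-- A (possibly time-varying) full-state controller: `π i s` is the scalar action at time `i` when
the state is `s`. -/
abbrev Controller (N : ℕ) := ℕ → (Fin N → ℂ) → ℂ

/-- All full-state controllers. -/
def fullStateControllers (N : ℕ) : Set (Controller N) :=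
  {π | ∀ i, Measurable (π i)}

/-- The controllers `π i s = ∑ j, p i j (s j)` acting on every mode separately. -/
def separatedControllers (N : ℕ) : Set (Controller N) :=
  {π | ∃ p : ℕ → Fin N → ℂ → ℂ, (∀ i j, Measurable (p i j)) ∧
    ∀ i s, π i s = ∑ j, p i j (s j)}

/-- The stationary linear controller `X = -C S`. -/
def linearController {N : ℕ} (C : Matrix (Fin 1) (Fin N) ℂ) : Controller N :=
  fun _ s => -((C *ᵥ s) 0)

section Dynamics

variable {N : ℕ} {Ω : Type*}

/-- The closed-loop state: `S 0 = M` and `S (i + 1) = A S i + B Y i`, where the channel output is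
`Y 0 = 0` (nothing is transmitted before time `1`) and `Y i = X i + Z i`, `X i = π i (S i)`,
for `i ≥ 1`. -/
def state (A : Matrix (Fin N) (Fin N) ℂ) (B : Matrix (Fin N) (Fin 1) ℂ) (π : Controller N)
    (M : Ω → Fin N → ℂ) (Z : ℕ → Ω → ℂ) : ℕ → Ω → Fin N → ℂ
  | 0, x => M x
  | i + 1, x =>
      A *ᵥ state A B π M Z i x +
        B *ᵥ fun _ => if i = 0 then 0 else π i (state A B π M Z i x) + Z i x

variable [MeasurableSpace Ω]

/-- The controller stabilizes the system: every mode has `limsup E|S n j|² < ∞`. -/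
def Stabilizes (A : Matrix (Fin N) (Fin N) ℂ) (B : Matrix (Fin N) (Fin 1) ℂ) (P : Measure Ω)
    (M : Ω → Fin N → ℂ) (Z : ℕ → Ω → ℂ) (π : Controller N) : Prop :=
  ∀ j, limsup (fun n => ∫⁻ x, ‖state A B π M Z n x j‖ₑ ^ 2 ∂P) atTop < ⊤

/-- The average power `(1 / n) ∑_{i = 1}^n E|X i|²`, possibly infinite. -/
def averagePower (A : Matrix (Fin N) (Fin N) ℂ) (B : Matrix (Fin N) (Fin 1) ℂ) (P : Measure Ω)
    (M : Ω → Fin N → ℂ) (Z : ℕ → Ω → ℂ) (π : Controller N) (n : ℕ) : ℝ≥0∞ :=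
  (∑ i ∈ Finset.Icc 1 n, ∫⁻ x, ‖π i (state A B π M Z i x)‖ₑ ^ 2 ∂P) / n

/-- The average mean-square distance `(1 / n) ∑_{i = 1}^n E|X i - ρ i (S i)|²` between the action
of `π` and the action that `ρ` would take, along the trajectory of `π`. -/
def averageDeviation (A : Matrix (Fin N) (Fin N) ℂ) (B : Matrix (Fin N) (Fin 1) ℂ)
    (P : Measure Ω) (M : Ω → Fin N → ℂ) (Z : ℕ → Ω → ℂ) (π ρ : Controller N) (n : ℕ) : ℝ≥0∞ :=
  (∑ i ∈ Finset.Icc 1 n,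
    ∫⁻ x, ‖π i (state A B π M Z i x) - ρ i (state A B π M Z i x)‖ₑ ^ 2 ∂P) / n

/-- `π` is a stabilizing controller in the class `𝒞`, has a finite asymptotic power, and no
stabilizing controller in `𝒞` does better; the `liminf` is the asymptotic power of the competitor
whenever the latter exists. -/
def IsOptimal (A : Matrix (Fin N) (Fin N) ℂ) (B : Matrix (Fin N) (Fin 1) ℂ) (P : Measure Ω)
    (M : Ω → Fin N → ℂ) (Z : ℕ → Ω → ℂ) (𝒞 : Set (Controller N)) (π : Controller N) : Prop :=
  π ∈ 𝒞 ∧ Stabilizes A B P M Z π ∧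
    ∃ p : ℝ≥0, Tendsto (averagePower A B P M Z π) atTop (𝓝 (p : ℝ≥0∞)) ∧
      ∀ σ ∈ 𝒞, Stabilizes A B P M Z σ →
        (p : ℝ≥0∞) ≤ liminf (averagePower A B P M Z σ) atTop

end Dynamics

/-- The gain `C = (B' G B + 1)⁻¹ B' G A`. -/
def gain {N : ℕ} (A : Matrix (Fin N) (Fin N) ℂ) (B : Matrix (Fin N) (Fin 1) ℂ)
    (G : Matrix (Fin N) (Fin N) ℂ) : Matrix (Fin 1) (Fin N) ℂ :=
  (Bᴴ * G * B + 1)⁻¹ * Bᴴ * G * A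

/-- `G` is a (Hermitian) positive definite solution of the discrete algebraic Riccati equation. -/
def IsPosDefRiccatiSolution {N : ℕ} (A : Matrix (Fin N) (Fin N) ℂ)
    (B : Matrix (Fin N) (Fin 1) ℂ) (G : Matrix (Fin N) (Fin N) ℂ) : Prop :=
  G.PosDef ∧ G = Aᴴ * G * A - Aᴴ * G * B * (Bᴴ * G * B + 1)⁻¹ * Bᴴ * G * A

end LTIControl

end

namespace LTIControl

open Matrix

/-! ### Algebra of the Riccati equation: its Lyapunov form and completion of the square. -/

section Riccati

variable {N : ℕ} {A G Q : Matrix (Fin N) (Fin N) ℂ} {B : Matrix (Fin N) (Fin 1) ℂ}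

/-! Write `F = A - B C` for the closed loop. The Riccati equation says `A' G F = G`. By the Woodbury
identity this is equivalent, for `G` positive definite, to the linear equation `A Q A' = Q + B B'`
for `Q = G⁻¹`. With `A` diagonal this decouples entrywise, so `Q j k = 1 / (a j * star (a k) - 1)`
is forced. Expanding in a geometric series shows that `Q` is a sum of rank-one squares, and it is
definite by a Vandermonde argument since the `a j` are distinct
(`existsUnique_isPosDefRiccatiSolution`).

Optimality comes from an exact cost identity (`cost_sum`). Completing the square and using that `Z
i` is centred and independent of `S i`, the energy `V n = E (S n)' G (S n)` satisfies `V (n+1) + ∑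
E|X i|² = V 1 + (B'GB + 1) ∑ E|X i + C S i|² + n B'GB`, with sums over `1 ≤ i ≤ n`. Stabilization
bounds `V`, so any average power is asymptotically at least `B'GB` plus the average deviation from
`-C S`. The controller `-C S` has no deviation and attains `B'GB`. It is separated because it is
linear, so it is optimal in both classes, and any optimal controller has vanishing average
deviation. It stabilizes because `A' G F = G` makes the rows of `G` left eigenvectors of `F` with
eigenvalues `1 / star (a k)`.

If a linear gain `K` is optimal, then `d = C - K` has `E|d S i|²` vanishing on average. Past noise
bounds this below by `|d (A - B K)^m B|²`, so all these responses vanish. State feedback does not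
change the controllable subspace, so `d A^m B = 0` for all `m`, and Vandermonde gives `d = 0`. -/

lemma inv_mul_gain_denominator (hG : G.PosSemidef) :
    (Bᴴ * G * B + 1)⁻¹ * (Bᴴ * G * B + 1) = 1 :=
  nonsing_inv_mul _ ((isUnit_iff_isUnit_det _).1
    ((PosDef.posSemidef_add (hG.conjTranspose_mul_mul_same B) PosDef.one).isUnit))

/-- The Woodbury identity for `1 + B * Bᴴ * G`. -/
lemma one_sub_mul_one_add (hG : G.PosSemidef) :
    (1 - B * (Bᴴ * G * B + 1)⁻¹ * Bᴴ * G) * (1 + B * Bᴴ * G) = 1 := by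
  have h1 := inv_mul_gain_denominator (B := B) hG
  generalize (Bᴴ * G * B + 1)⁻¹ = H at *
  have h2 : H * (Bᴴ * G * B) = 1 - H := by
    rw [mul_add, mul_one] at h1
    exact eq_sub_of_add_eq h1
  calc (1 - B * H * Bᴴ * G) * (1 + B * Bᴴ * G)
      = 1 + B * (Bᴴ * G) - B * H * (Bᴴ * G) - B * (H * (Bᴴ * G * B)) * (Bᴴ * G) := by
        simp only [Matrix.mul_assoc, Matrix.sub_mul, Matrix.mul_add, Matrix.one_mul,
          Matrix.mul_one]
        abel
    _ = 1 := by
        rw [h2]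
        simp only [Matrix.mul_assoc, Matrix.sub_mul, Matrix.mul_sub, Matrix.one_mul]
        abel

lemma closedLoop_eq :
    A - B * gain A B G = (1 - B * (Bᴴ * G * B + 1)⁻¹ * Bᴴ * G) * A := by
  simp only [gain, Matrix.mul_assoc, Matrix.sub_mul, Matrix.one_mul]

/-- The Riccati equation in closed-loop form. -/
lemma riccati_iff :
    G = Aᴴ * G * A - Aᴴ * G * B * (Bᴴ * G * B + 1)⁻¹ * Bᴴ * G * A ↔
      Aᴴ * G * (A - B * gain A B G) = G := by
  have : Aᴴ * G * (A - B * gain A B G) =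
      Aᴴ * G * A - Aᴴ * G * B * (Bᴴ * G * B + 1)⁻¹ * Bᴴ * G * A := by
    simp only [gain, Matrix.mul_assoc, Matrix.mul_sub]
  rw [this, eq_comm]

/-- The inverse of a Riccati solution solves a Lyapunov equation. -/
lemma IsPosDefRiccatiSolution.lyapunov (h : IsPosDefRiccatiSolution A B G) :
    A * G⁻¹ * Aᴴ = G⁻¹ + B * Bᴴ := by
  have hu := (isUnit_iff_isUnit_det _).1 h.1.isUnit
  have h1 := riccati_iff.1 h.2
  have h2 : G⁻¹ * Aᴴ * G * (A - B * gain A B G) = 1 := by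
    rw [Matrix.mul_assoc, Matrix.mul_assoc, ← Matrix.mul_assoc Aᴴ, h1, nonsing_inv_mul _ hu]
  -- One-sided inverses of square matrices are two-sided; this moves `F` to the left, where it
  -- factors as (Woodbury inverse) `* A`.
  have h3 := mul_eq_one_comm.1 h2
  have h4 : (1 - B * (Bᴴ * G * B + 1)⁻¹ * Bᴴ * G) * (A * G⁻¹ * Aᴴ) = G⁻¹ := by
    have := congrArg (· * G⁻¹) h3
    simp only [closedLoop_eq, Matrix.mul_assoc, mul_nonsing_inv _ hu, Matrix.mul_one,
      Matrix.one_mul] at this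
    simpa only [Matrix.mul_assoc] using this
  have h5 := mul_eq_one_comm.1 (one_sub_mul_one_add (B := B) h.1.posSemidef)
  calc A * G⁻¹ * Aᴴ
      = (1 + B * Bᴴ * G) *
          ((1 - B * (Bᴴ * G * B + 1)⁻¹ * Bᴴ * G) * (A * G⁻¹ * Aᴴ)) := by
        rw [← Matrix.mul_assoc, h5, Matrix.one_mul]
    _ = G⁻¹ + B * Bᴴ := by
        rw [h4, Matrix.add_mul, Matrix.one_mul, Matrix.mul_assoc _ G, mul_nonsing_inv _ hu,
          Matrix.mul_one]

/-- The inverse of a positive definite solution of the Lyapunov equation solves the Riccati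
equation. -/
lemma isPosDefRiccatiSolution_inv (hQ : Q.PosDef) (h : A * Q * Aᴴ = Q + B * Bᴴ) :
    IsPosDefRiccatiSolution A B Q⁻¹ := by
  refine ⟨hQ.inv, riccati_iff.2 ?_⟩
  have hu := (isUnit_iff_isUnit_det _).1 hQ.isUnit
  have h1 := one_sub_mul_one_add (B := B) hQ.inv.posSemidef
  have h2 : A * Q * Aᴴ * Q⁻¹ = 1 + B * Bᴴ * Q⁻¹ := by
    rw [h, Matrix.add_mul, mul_nonsing_inv _ hu]
  rw [← h2] at h1
  have h3 : (A - B * gain A B Q⁻¹) * (Q * Aᴴ * Q⁻¹) = 1 := by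
    rw [closedLoop_eq]
    simpa only [Matrix.mul_assoc] using h1
  have h4 := congrArg (Q⁻¹ * ·) (mul_eq_one_comm.1 h3)
  simpa only [← Matrix.mul_assoc, nonsing_inv_mul _ hu, Matrix.one_mul, Matrix.mul_one] using h4

/-- Multiplying the gain by its denominator gives `B'GA = (B'GB + 1) C`. This identity is what
cancels the cross terms in `complete_square`. -/
lemma conjTranspose_mul_closedLoop (hG : G.PosSemidef) :
    Bᴴ * G * (A - B * gain A B G) = gain A B G := by
  have h1 := inv_mul_gain_denominator (B := B) hG
  have h2 : (Bᴴ * G * B + 1) * gain A B G = Bᴴ * G * A := by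
    simp only [gain, ← Matrix.mul_assoc]
    rw [mul_eq_one_comm.1 h1, Matrix.one_mul]
  rw [Matrix.mul_sub, ← h2]
  simp only [Matrix.mul_assoc, Matrix.add_mul, Matrix.one_mul]
  abel

/-- Completion of the square for the quadratic cost. -/
lemma IsPosDefRiccatiSolution.complete_square (h : IsPosDefRiccatiSolution A B G)
    (s : Matrix (Fin N) (Fin 1) ℂ) (x : Matrix (Fin 1) (Fin 1) ℂ) :
    (A * s + B * x)ᴴ * G * (A * s + B * x) + xᴴ * x =
      sᴴ * G * s + (x + gain A B G * s)ᴴ * (Bᴴ * G * B + 1) * (x + gain A B G * s) := by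
  have h1 := riccati_iff.1 h.2
  have h2 := conjTranspose_mul_closedLoop (A := A) (B := B) h.1.posSemidef
  have hG : Gᴴ = G := h.1.1
  generalize gain A B G = C at h1 h2 ⊢
  clear h
  -- In the coordinates `e = x + C s` and `F = A - B C` the next state is `F s + B e`, and `F'GB =
  -- C'`, `F'GF = G - C'C` cancel the expansion of `|e - C s|²` apart from `|e|²`.
  obtain ⟨e, rfl⟩ : ∃ e, x = e - C * s := ⟨x + C * s, by abel⟩
  obtain ⟨F, rfl⟩ : ∃ F, A = F + B * C := ⟨A - B * C, by abel⟩
  rw [add_sub_cancel_right] at h1 h2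
  have h3 : Fᴴ * G * B = Cᴴ := by
    have := congrArg conjTranspose h2
    simpa only [conjTranspose_mul, conjTranspose_conjTranspose, hG, Matrix.mul_assoc] using this
  have e1 : (F + B * C) * s + B * (e - C * s) = F * s + B * e := by
    simp only [Matrix.add_mul, Matrix.mul_sub, Matrix.mul_assoc]; abel
  have h4 : Fᴴ * G * F = G - Cᴴ * C := by
    rw [conjTranspose_add, conjTranspose_mul, Matrix.add_mul, Matrix.add_mul,
      Matrix.mul_assoc Cᴴ, Matrix.mul_assoc Cᴴ, h2] at h1
    exact eq_sub_of_add_eq h1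
  rw [e1, sub_add_cancel]
  calc (F * s + B * e)ᴴ * G * (F * s + B * e) + (e - C * s)ᴴ * (e - C * s)
      = sᴴ * (Fᴴ * G * F) * s + sᴴ * (Fᴴ * G * B) * e + eᴴ * (Bᴴ * G * F) * s
          + eᴴ * (Bᴴ * G * B) * e + (eᴴ * e - eᴴ * C * s - sᴴ * Cᴴ * e + sᴴ * (Cᴴ * C) * s) := by
        simp only [conjTranspose_add, conjTranspose_sub, conjTranspose_mul, Matrix.mul_assoc,
          Matrix.add_mul, Matrix.mul_add, Matrix.sub_mul, Matrix.mul_sub]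
        abel
    _ = sᴴ * G * s + eᴴ * (Bᴴ * G * B + 1) * e := by
        rw [h2, h3, h4]
        simp only [Matrix.add_mul, Matrix.mul_add, Matrix.sub_mul, Matrix.mul_sub,
          Matrix.mul_one]
        abel

end Riccati

/-! ### The Gramian: explicit solution of the Lyapunov equation and its definiteness. -/

section Gram

variable {N : ℕ} {a : Fin N → ℂ}

/-- The Gramian solving the Lyapunov equation of the diagonal system. -/
noncomputable def gramian (a : Fin N → ℂ) : Matrix (Fin N) (Fin N) ℂ :=
  fun j k => (a j * star (a k) - 1)⁻¹

lemma mul_star_sub_one_ne_zero (ha : ∀ j, 1 < ‖a j‖) (j k : Fin N) :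
    a j * star (a k) - 1 ≠ 0 := by
  intro h
  have h1 : ‖a j * star (a k)‖ = 1 := by rw [sub_eq_zero.1 h, norm_one]
  rw [norm_mul, norm_star] at h1
  nlinarith [ha j, ha k]

/-- For diagonal `A` the equation is scalar in each entry: `(a j * star (a k) - 1) * Q j k = 1`. -/
lemma lyapunov_iff (ha : ∀ j, 1 < ‖a j‖) (Q : Matrix (Fin N) (Fin N) ℂ) :
    diagonal a * Q * (diagonal a)ᴴ = Q + inputMatrix N * (inputMatrix N)ᴴ ↔ Q = gramian a := by
  have key (j k : Fin N) :
      (diagonal a * Q * (diagonal a)ᴴ) j k = (Q + inputMatrix N * (inputMatrix N)ᴴ) j k ↔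
        Q j k = gramian a j k := by
    have := mul_star_sub_one_ne_zero ha j k
    rw [diagonal_conjTranspose, mul_diagonal, diagonal_mul, gramian,
      ← mul_eq_one_iff_eq_inv₀ this]
    simp only [Matrix.add_apply, Matrix.mul_apply, inputMatrix, conjTranspose_apply, Pi.star_apply,
      star_one, mul_one, Finset.univ_unique, Finset.sum_const, Finset.card_singleton, one_smul]
    constructor <;> intro h <;> linear_combination h
  constructor
  · intro h
    ext j k
    exact (key j k).1 (congrFun (congrFun h j) k)
  · intro h
    ext j k
    exact (key j k).2 (congrFun (congrFun h j) k)

/-- Uses `1 / (z - 1) = ∑ z⁻¹ ^ (n + 1)` at `z = a j * star (a k)`, which has modulus above one;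
each power splits into a factor in `j` and a factor in `k`. -/
lemma hasSum_gramian_quadraticForm (ha : ∀ j, 1 < ‖a j‖) (x : Fin N → ℂ) :
    HasSum (fun n : ℕ => (star (∑ j, star (a j)⁻¹ ^ (n + 1) * x j)) *
      ∑ j, star (a j)⁻¹ ^ (n + 1) * x j) (star x ⬝ᵥ (gramian a *ᵥ x)) := by
  have h0 (j) : a j ≠ 0 := by
    intro h; have := ha j; rw [h, norm_zero] at this; linarith
  have h1 (j k : Fin N) : HasSum (fun n : ℕ => ((a j)⁻¹ * star (a k)⁻¹) ^ (n + 1))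
      (gramian a j k) := by
    have hn : ‖(a j)⁻¹ * star (a k)⁻¹‖ < 1 := by
      rw [norm_mul, norm_star, norm_inv, norm_inv]
      exact mul_lt_one_of_nonneg_of_lt_one_left (by positivity) (inv_lt_one_of_one_lt₀ (ha j))
        (inv_lt_one_of_one_lt₀ (ha k)).le
    have := (hasSum_geometric_of_norm_lt_one hn).mul_left ((a j)⁻¹ * star (a k)⁻¹)
    simp only [← pow_succ'] at this
    have h2 := mul_star_sub_one_ne_zero ha j k
    have h3 := h0 j
    have h4 : star (a k) ≠ 0 := star_ne_zero.2 (h0 k)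
    have h5 : (a j)⁻¹ * star (a k)⁻¹ * (1 - (a j)⁻¹ * star (a k)⁻¹)⁻¹ = gramian a j k := by
      change _ = (a j * star (a k) - 1)⁻¹
      rw [star_inv₀, eq_comm, inv_eq_iff_eq_inv, mul_inv, inv_inv, mul_inv, inv_inv, inv_inv]
      field_simp
    exact h5 ▸ this
  have h2 : HasSum (fun n : ℕ => ∑ j, ∑ k,
      star (x j) * (((a j)⁻¹ * star (a k)⁻¹) ^ (n + 1) * x k))
      (∑ j, ∑ k, star (x j) * (gramian a j k * x k)) :=
    hasSum_sum fun j _ => hasSum_sum fun k _ => ((h1 j k).mul_right _).mul_left _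
  convert h2 using 1
  · ext n
    rw [star_sum, Finset.sum_mul_sum]
    refine Finset.sum_congr rfl fun j _ => Finset.sum_congr rfl fun k _ => ?_
    simp only [star_mul', star_pow, star_star]
    ring
  · simp [dotProduct, mulVec, Finset.mul_sum]

lemma gramian_posDef (ha : ∀ j, 1 < ‖a j‖) (hinj : Function.Injective a) :
    (gramian a).PosDef := by
  refine PosDef.of_dotProduct_mulVec_pos ?_ fun x hx => ?_
  · ext j k
    simp only [gramian, conjTranspose_apply, star_inv₀, star_sub, star_mul', star_star, star_one]
    ring
  have hs := hasSum_gramian_quadraticForm ha x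
  obtain ⟨n, hn⟩ : ∃ n : ℕ, ∑ j, star (a j)⁻¹ ^ (n + 1) * x j ≠ 0 := by
    by_contra! h
    -- The exponents start at one, so one factor is absorbed into the vector before applying
    -- Vandermonde.
    have h0 : (fun j => star (a j)⁻¹ * x j) = 0 := by
      refine eq_zero_of_forall_pow_sum_mul_pow_eq_zero (f := fun j => star (a j)⁻¹) ?_ fun i => ?_
      · exact star_injective.comp (inv_injective.comp hinj)
      · rw [← h i]
        exact Finset.sum_congr rfl fun j _ => by ring
    refine hx (funext fun j => ?_)
    have hj := congrFun h0 j
    have h1 : a j ≠ 0 := by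
      intro h; have := ha j; rw [h, norm_zero] at this; linarith
    simpa [h1] using hj
  have hp : (0 : ℂ) < star (∑ j, star (a j)⁻¹ ^ (n + 1) * x j) *
      ∑ j, star (a j)⁻¹ ^ (n + 1) * x j := star_mul_self_pos (IsRegular.of_ne_zero hn)
  exact hp.trans_le (le_hasSum hs n fun m _ => star_mul_self_nonneg _)

theorem existsUnique_isPosDefRiccatiSolution (ha : ∀ j, 1 < ‖a j‖)
    (hinj : Function.Injective a) :
    ∃! G, IsPosDefRiccatiSolution (diagonal a) (inputMatrix N) G := by
  have hQ := gramian_posDef ha hinj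
  refine ⟨(gramian a)⁻¹, isPosDefRiccatiSolution_inv hQ ((lyapunov_iff ha _).2 rfl),
    fun G hG => ?_⟩
  rw [← (lyapunov_iff ha _).1 hG.lyapunov,
    nonsing_inv_nonsing_inv _ ((isUnit_iff_isUnit_det _).1 hG.1.isUnit)]

end Gram

end LTIControl

namespace LTIControl

/-! ### Second moments under Gaussian noise. -/

section Noise

instance : IsProbabilityMeasure stdComplexGaussian :=
  Measure.isProbabilityMeasure_map Complex.measurableEquivRealProd.symm.measurable.aemeasurable

/-- The second moment of an affine function of a standard complex Gaussian. -/
lemma lintegral_enorm_add_mul_sq_stdComplexGaussian (c b : ℂ) :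
    ∫⁻ z, ‖c + b * z‖ₑ ^ 2 ∂stdComplexGaussian = ‖c‖ₑ ^ 2 + ‖b‖ₑ ^ 2 := by
  have hX : MemLp id 2 (gaussianReal 0 (1 / 2)) := memLp_id_gaussianReal 2
  have hI : Integrable (fun x : ℝ => x) (gaussianReal 0 (1 / 2)) :=
    hX.integrable (by norm_num)
  have hI2 : Integrable (fun x : ℝ => x ^ 2) (gaussianReal 0 (1 / 2)) := hX.integrable_sq
  have h1 : ∫ x, x ∂(gaussianReal 0 (1 / 2)) = 0 := integral_id_gaussianReal
  have h2 : ∫ x, x ^ 2 ∂(gaussianReal 0 (1 / 2)) = 1 / 2 := by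
    have h := variance_of_integral_eq_zero (X := fun x : ℝ => x) (μ := gaussianReal 0 (1 / 2))
      aemeasurable_id h1
    have h' : Var[fun x : ℝ => x; gaussianReal 0 (1 / 2)] = ((1 / 2 : ℝ≥0) : ℝ) :=
      variance_fun_id_gaussianReal
    rw [← h, h']
    norm_num
  -- The cross terms are linear in the real and imaginary parts and integrate to zero; the two
  -- squares contribute `‖b‖² / 2` each.
  have hpt (p : ℝ × ℝ) : ‖c + b * Complex.measurableEquivRealProd.symm p‖ ^ 2 =
      ‖c‖ ^ 2 + (2 * (c.re * b.re + c.im * b.im) * p.1 +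
        (2 * (c.im * b.re - c.re * b.im) * p.2 + (‖b‖ ^ 2 * p.1 ^ 2 + ‖b‖ ^ 2 * p.2 ^ 2))) := by
    simp only [Complex.sq_norm, Complex.normSq_apply, Complex.add_re, Complex.add_im,
      Complex.mul_re, Complex.mul_im, Complex.measurableEquivRealProd_symm_apply]
    ring
  set μ := gaussianReal 0 (1 / 2)
  have i1 : Integrable (fun p : ℝ × ℝ => p.1) (μ.prod μ) := hI.comp_fst μ
  have i2 : Integrable (fun p : ℝ × ℝ => p.2) (μ.prod μ) := hI.comp_snd μ
  have i3 : Integrable (fun p : ℝ × ℝ => p.1 ^ 2) (μ.prod μ) := hI2.comp_fst μ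
  have i4 : Integrable (fun p : ℝ × ℝ => p.2 ^ 2) (μ.prod μ) := hI2.comp_snd μ
  have e1 : ∫ p, p.1 ∂(μ.prod μ) = 0 := by
    rw [integral_fun_fst (fun x : ℝ => x), h1, smul_zero]
  have e2 : ∫ p, p.2 ∂(μ.prod μ) = 0 := by
    rw [integral_fun_snd (fun x : ℝ => x), h1, smul_zero]
  have e3 : ∫ p, p.1 ^ 2 ∂(μ.prod μ) = 1 / 2 := by
    rw [integral_fun_fst (fun x : ℝ => x ^ 2), h2, probReal_univ, one_smul]
  have e4 : ∫ p, p.2 ^ 2 ∂(μ.prod μ) = 1 / 2 := by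
    rw [integral_fun_snd (fun x : ℝ => x ^ 2), h2, probReal_univ, one_smul]
  rw [stdComplexGaussian, lintegral_map_equiv]
  rw [← ofReal_norm, ← ofReal_norm, ← ENNReal.ofReal_pow (norm_nonneg _),
    ← ENNReal.ofReal_pow (norm_nonneg _), ← ENNReal.ofReal_add (by positivity) (by positivity)]
  have j4 := (i3.const_mul (‖b‖ ^ 2)).add (i4.const_mul (‖b‖ ^ 2))
  have j3 := (i2.const_mul (2 * (c.im * b.re - c.re * b.im))).add j4
  have j2 := (i1.const_mul (2 * (c.re * b.re + c.im * b.im))).add j3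
  have j1 := (integrable_const (μ := μ.prod μ) (‖c‖ ^ 2)).add j2
  have hval := integral_add (integrable_const (μ := μ.prod μ) (‖c‖ ^ 2)) j2
  rw [integral_add' (i1.const_mul _) j3, integral_add' (i2.const_mul _) j4,
    integral_add' (i3.const_mul _) (i4.const_mul _), integral_const_mul, integral_const_mul,
    integral_const_mul, integral_const_mul, e1, e2, e3, e4] at hval
  have hval' : ‖c‖ ^ 2 + ‖b‖ ^ 2 = ∫ p, (‖c‖ ^ 2 + (2 * (c.re * b.re + c.im * b.im) * p.1 +
        (2 * (c.im * b.re - c.re * b.im) * p.2 + (‖b‖ ^ 2 * p.1 ^ 2 + ‖b‖ ^ 2 * p.2 ^ 2))))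
        ∂(μ.prod μ) := by
    refine Eq.trans ?_ hval.symm
    simp
    ring
  rw [hval']
  refine Eq.trans (lintegral_congr fun p => ?_) (ofReal_integral_eq_lintegral_ofReal j1 ?_).symm
  · rw [← ofReal_norm, ← ENNReal.ofReal_pow (norm_nonneg _), hpt]
    rfl
  · refine ae_of_all _ fun p => ?_
    simp only [Pi.zero_apply, Pi.add_apply, ← hpt]
    positivity

/-- Independence makes the joint law a product, so the Gaussian formula applies with `W` frozen.
Working in `ℝ≥0∞` avoids any integrability assumption on `W`. -/
lemma lintegral_enorm_add_mul_sq {Ω : Type*} [MeasurableSpace Ω] {P : Measure Ω}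
    [IsProbabilityMeasure P] {W V : Ω → ℂ} (hW : Measurable W) (hV : Measurable V)
    (hlaw : P.map V = stdComplexGaussian) (hind : IndepFun W V P) (b : ℂ) :
    ∫⁻ x, ‖W x + b * V x‖ₑ ^ 2 ∂P = ∫⁻ x, ‖W x‖ₑ ^ 2 ∂P + ‖b‖ₑ ^ 2 := by
  have hmap := (indepFun_iff_map_prod_eq_prod_map_map hW.aemeasurable hV.aemeasurable).1 hind
  have hf : Measurable fun p : ℂ × ℂ => ‖p.1 + b * p.2‖ₑ ^ 2 := by fun_prop
  have : IsProbabilityMeasure (P.map W) := Measure.isProbabilityMeasure_map hW.aemeasurable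
  have hg : Measurable fun c : ℂ => ‖c‖ₑ ^ 2 := by fun_prop
  calc ∫⁻ x, ‖W x + b * V x‖ₑ ^ 2 ∂P
      = ∫⁻ p, ‖p.1 + b * p.2‖ₑ ^ 2 ∂(P.map fun x => (W x, V x)) :=
        (lintegral_map hf (hW.prodMk hV)).symm
    _ = ∫⁻ c, ‖c‖ₑ ^ 2 + ‖b‖ₑ ^ 2 ∂(P.map W) := by
        rw [hmap, hlaw, lintegral_prod _ hf.aemeasurable]
        exact lintegral_congr fun c => lintegral_enorm_add_mul_sq_stdComplexGaussian c b
    _ = ∫⁻ x, ‖W x‖ₑ ^ 2 ∂P + ‖b‖ₑ ^ 2 := by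
        rw [lintegral_add_right _ measurable_const, lintegral_map hg hW]
        simp

end Noise

/-! ### Independence of the current state and the current noise. -/

section Independence

variable {N : ℕ} {Ω : Type*} {A : Matrix (Fin N) (Fin N) ℂ} {B : Matrix (Fin N) (Fin 1) ℂ}
  {π : Controller N} {M : Ω → Fin N → ℂ} {Z : ℕ → Ω → ℂ}

/-- The state at time `i` is a measurable function of the message and the earlier noise. -/
lemma exists_measurable_state_eq (hπ : ∀ i, Measurable (π i)) (i : ℕ) :
    ∃ φ : (Fin N → ℂ) × (Finset.range i → ℂ) → Fin N → ℂ, Measurable φ ∧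
      ∀ x, state A B π M Z i x = φ (M x, fun k => Z k x) := by
  induction i with
  | zero => exact ⟨Prod.fst, measurable_fst, fun x => rfl⟩
  | succ i ih =>
    obtain ⟨φ, hφ, h⟩ := ih
    have hmem {k : ℕ} (hk : k ∈ Finset.range i) : k ∈ Finset.range (i + 1) :=
      Finset.mem_range.2 ((Finset.mem_range.1 hk).trans (Nat.lt_succ_self i))
    let r : (Fin N → ℂ) × (Finset.range (i + 1) → ℂ) → (Fin N → ℂ) × (Finset.range i → ℂ) :=
      fun p => (p.1, fun k => p.2 ⟨k, hmem k.2⟩)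
    have hr : Measurable r := by fun_prop
    have hφr := hφ.comp hr
    have hπr := (hπ i).comp hφr
    refine ⟨fun p => A.mulVec (φ (r p)) + B.mulVec fun _ => if i = 0 then 0 else
      π i (φ (r p)) + p.2 ⟨i, Finset.self_mem_range_succ i⟩, ?_, fun x => ?_⟩
    · have h1 : Measurable fun s : Fin N → ℂ => A.mulVec s :=
        (Continuous.matrix_mulVec continuous_const continuous_id).measurable
      have h2 : Measurable fun s : Fin 1 → ℂ => B.mulVec s :=
        (Continuous.matrix_mulVec continuous_const continuous_id).measurable
      refine (h1.comp hφr).add (h2.comp (measurable_pi_lambda _ fun _ => ?_))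
      split_ifs
      · exact measurable_const
      · exact hπr.add ((measurable_pi_apply _).comp measurable_snd)
    · simp only [state, h, r]

variable [MeasurableSpace Ω] {P : Measure Ω}

lemma IsChannelModel.measurable_state (h : IsChannelModel P M Z)
    (hπ : ∀ i, Measurable (π i)) (i : ℕ) : Measurable (state A B π M Z i) := by
  obtain ⟨φ, hφ, e⟩ := exists_measurable_state_eq (A := A) (B := B) (M := M) (Z := Z) hπ i
  rw [funext e]
  exact hφ.comp (h.measurable_message.prodMk
    (measurable_pi_lambda _ fun k => h.measurable_noise k))

variable [IsProbabilityMeasure P]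

lemma IsChannelModel.indepFun_past (h : IsChannelModel P M Z) (i : ℕ) :
    IndepFun (fun x => (M x, fun k : Finset.range i => Z k x)) (Z i) P := by
  have hM := h.measurable_message
  have hZ := h.measurable_noise
  have hpast : Measurable fun x (k : Finset.range i) => Z k x :=
    measurable_pi_lambda _ fun k => hZ k
  have h1 : IndepFun (fun x (k : Finset.range i) => Z k x) (Z i) P := by
    have := h.noise_indep.indepFun_finset (Finset.range i) {i} (by simp) hZ
    exact this.comp (φ := id) (ψ := fun f : ({i} : Finset ℕ) → ℂ => f ⟨i, by simp⟩)
      measurable_id (measurable_pi_apply _)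
  have h2 : IndepFun M (fun x => ((fun k : Finset.range i => Z k x), Z i x)) P :=
    h.message_noise_indep.comp (φ := id)
      (ψ := fun f : ℕ → ℂ => ((fun k : Finset.range i => f k), f i)) measurable_id (by fun_prop)
  have h3 : IndepFun M (fun x (k : Finset.range i) => Z k x) P :=
    h2.comp (φ := id) (ψ := Prod.fst) measurable_id measurable_fst
  have e1 := (indepFun_iff_map_prod_eq_prod_map_map hpast.aemeasurable (hZ i).aemeasurable).1 h1
  have e2 := (indepFun_iff_map_prod_eq_prod_map_map hM.aemeasurable
    (hpast.prodMk (hZ i)).aemeasurable).1 h2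
  have e3 := (indepFun_iff_map_prod_eq_prod_map_map hM.aemeasurable hpast.aemeasurable).1 h3
  rw [indepFun_iff_map_prod_eq_prod_map_map (hM.prodMk hpast).aemeasurable (hZ i).aemeasurable,
    e3]
  have : IsProbabilityMeasure (P.map (Z i)) :=
    Measure.isProbabilityMeasure_map (hZ i).aemeasurable
  -- Up to reassociation, the law of (message, past, present) is a triple product: first split off
  -- the message, then separate past and present noise.
  rw [← MeasurableEquiv.prodAssoc.map_measurableEquiv_injective.eq_iff, Measure.prodAssoc_prod,
    ← e1, ← e2, Measure.map_map MeasurableEquiv.prodAssoc.measurable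
      ((hM.prodMk hpast).prodMk (hZ i))]
  rfl

lemma IsChannelModel.indepFun_state (h : IsChannelModel P M Z)
    (hπ : ∀ i, Measurable (π i)) (i : ℕ) : IndepFun (state A B π M Z i) (Z i) P := by
  obtain ⟨φ, hφ, e⟩ := exists_measurable_state_eq (A := A) (B := B) (M := M) (Z := Z) hπ i
  rw [funext e]
  exact (h.indepFun_past i).comp (ψ := id) hφ measurable_id

/-- The second moment of a linear functional of the next state. -/
lemma IsChannelModel.lintegral_dotProduct_state_succ (h : IsChannelModel P M Z)
    (hπ : ∀ i, Measurable (π i)) {i : ℕ} (hi : i ≠ 0) (d : Fin N → ℂ) :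
    ∫⁻ x, ‖d ⬝ᵥ state A B π M Z (i + 1) x‖ₑ ^ 2 ∂P =
      ∫⁻ x, ‖d ⬝ᵥ (A.mulVec (state A B π M Z i x) +
        B.mulVec fun _ => π i (state A B π M Z i x))‖ₑ ^ 2 ∂P + ‖d ⬝ᵥ B.col 0‖ₑ ^ 2 := by
  let ψ : (Fin N → ℂ) → ℂ := fun s => d ⬝ᵥ (A.mulVec s + B.mulVec fun _ => π i s)
  have hψ : Measurable ψ := by
    have := hπ i
    simp only [ψ, dotProduct, Matrix.mulVec, Pi.add_apply]
    fun_prop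
  have hS := h.measurable_state (A := A) (B := B) hπ i
  refine Eq.trans (lintegral_congr fun x => ?_) (lintegral_enorm_add_mul_sq (hψ.comp hS)
    (h.measurable_noise i) (h.noise_law i)
    ((h.indepFun_state hπ i).comp (ψ := id) hψ measurable_id) _)
  congr 2
  simp only [state, hi, if_false, ψ, Function.comp, Matrix.mulVec, Matrix.col_apply, dotProduct, Pi.add_apply,
    Finset.univ_unique, Finset.sum_singleton, Fin.default_eq_zero, Fin.isValue]
  rw [Finset.sum_mul, ← Finset.sum_add_distrib]
  exact Finset.sum_congr rfl fun j _ => by ring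

end Independence

end LTIControl

namespace LTIControl

open Matrix

variable {N : ℕ} {Ω : Type*} {A G L : Matrix (Fin N) (Fin N) ℂ} {B : Matrix (Fin N) (Fin 1) ℂ}
  {π : Controller N} {M : Ω → Fin N → ℂ} {Z : ℕ → Ω → ℂ}

/-! ### Finite moments and reformulation of stability. -/

section Moments

lemma enorm_dotProduct_sq_le (d s : Fin N → ℂ) :
    ‖d ⬝ᵥ s‖ₑ ^ 2 ≤ ((∑ j, ‖d j‖₊ ^ 2 : ℝ≥0) : ℝ≥0∞) * ∑ j, ‖s j‖ₑ ^ 2 := by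
  have h : ‖d ⬝ᵥ s‖₊ ^ 2 ≤ (∑ j, ‖d j‖₊ ^ 2) * ∑ j, ‖s j‖₊ ^ 2 := by
    calc ‖d ⬝ᵥ s‖₊ ^ 2 ≤ (∑ j, ‖d j‖₊ * ‖s j‖₊) ^ 2 := by
          gcongr
          exact (nnnorm_sum_le _ _).trans_eq (Finset.sum_congr rfl fun j _ => nnnorm_mul _ _)
      _ ≤ _ := Finset.sum_mul_sq_le_sq_mul_sq _ _ _
  simp only [enorm_eq_nnnorm]
  exact_mod_cast h

variable [MeasurableSpace Ω] {P : Measure Ω}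

lemma measurable_enorm_dotProduct_sq {U : Ω → Fin N → ℂ} (hU : Measurable U) (d : Fin N → ℂ) :
    Measurable fun x => ‖d ⬝ᵥ U x‖ₑ ^ 2 := by
  simp only [dotProduct]
  fun_prop

lemma lintegral_enorm_dotProduct_sq_le {U : Ω → Fin N → ℂ} (hU : Measurable U)
    (d : Fin N → ℂ) :
    ∫⁻ x, ‖d ⬝ᵥ U x‖ₑ ^ 2 ∂P ≤
      ((∑ j, ‖d j‖₊ ^ 2 : ℝ≥0) : ℝ≥0∞) * ∑ j, ∫⁻ x, ‖U x j‖ₑ ^ 2 ∂P := by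
  have hm (j : Fin N) : Measurable fun x => ‖U x j‖ₑ ^ 2 := by fun_prop
  calc ∫⁻ x, ‖d ⬝ᵥ U x‖ₑ ^ 2 ∂P
      ≤ ∫⁻ x, ((∑ j, ‖d j‖₊ ^ 2 : ℝ≥0) : ℝ≥0∞) * ∑ j, ‖U x j‖ₑ ^ 2 ∂P :=
        lintegral_mono fun x => enorm_dotProduct_sq_le d (U x)
    _ = _ := by
        rw [lintegral_const_mul _ (Finset.measurable_sum _ fun j _ => hm j),
          lintegral_finsetSum _ fun j _ => hm j]

lemma eventually_lintegral_enorm_dotProduct_sq_le {U : ℕ → Ω → Fin N → ℂ}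
    (hU : ∀ n, Measurable (U n))
    (h : ∀ j, ∃ K : ℝ≥0, ∀ᶠ n in atTop, ∫⁻ x, ‖U n x j‖ₑ ^ 2 ∂P ≤ K) (d : Fin N → ℂ) :
    ∃ K : ℝ≥0, ∀ᶠ n in atTop, ∫⁻ x, ‖d ⬝ᵥ U n x‖ₑ ^ 2 ∂P ≤ K := by
  choose K hK using h
  refine ⟨(∑ j, ‖d j‖₊ ^ 2) * ∑ j, K j, ?_⟩
  filter_upwards [eventually_all.2 hK] with n hn
  refine (lintegral_enorm_dotProduct_sq_le (hU n) d).trans ?_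
  push_cast
  gcongr with j
  exact hn j

lemma stabilizes_iff :
    Stabilizes A B P M Z π ↔
      ∀ j, ∃ K : ℝ≥0, ∀ᶠ n in atTop, ∫⁻ x, ‖state A B π M Z n x j‖ₑ ^ 2 ∂P ≤ K := by
  refine forall_congr' fun j => ⟨fun h => ?_, fun ⟨K, hK⟩ => ?_⟩
  · obtain ⟨K, h1, h2⟩ := exists_between h
    lift K to ℝ≥0 using h2.ne
    exact ⟨K, (eventually_lt_of_limsup_lt h1).mono fun n hn => hn.le⟩
  · exact (limsup_le_of_le (by isBoundedDefault) hK).trans_lt ENNReal.coe_lt_top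

/-- The message has finite second moments. -/
lemma IsChannelModel.lintegral_message_lt_top [IsProbabilityMeasure P] (h : IsChannelModel P M Z)
    (j : Fin N) : ∫⁻ x, ‖M x j‖ₑ ^ 2 ∂P < ⊤ := by
  have hbox : MeasurableSet (messageBox N) := by
    refine MeasurableSet.univ_pi fun _ => ?_
    exact (measurableSet_Ioo.preimage Complex.measurable_re).inter
      (measurableSet_Ioo.preimage Complex.measurable_im)
  have hae : ∀ᵐ x ∂P, M x ∈ messageBox N := by
    refine ae_of_ae_map h.measurable_message.aemeasurable ?_
    rw [h.message_uniform]
    exact ae_cond_mem hbox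
  have hle : ∫⁻ x, ‖M x j‖ₑ ^ 2 ∂P ≤ ∫⁻ _, 4 ∂P := by
    refine lintegral_mono_ae (hae.mono fun x hx => ?_)
    have hj := hx j (Set.mem_univ j)
    obtain ⟨h1, h2⟩ := Complex.mem_reProdIm.1 hj
    have h3 : ‖M x j‖ ≤ 2 := by
      refine (Complex.norm_le_abs_re_add_abs_im _).trans ?_
      rw [abs_of_pos h1.1, abs_of_pos h2.1]
      linarith [h1.2, h2.2]
    have h4 : ‖M x j‖ₑ ≤ 2 := by
      rw [enorm_eq_nnnorm]
      exact_mod_cast h3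
    calc ‖M x j‖ₑ ^ 2 ≤ 2 ^ 2 := by gcongr
      _ = 4 := by norm_num
  refine hle.trans_lt ?_
  simp

/-- Since `Y 0 = 0`, the first state is `A M` whatever the controller. The cost recursion starts
here. -/
lemma IsChannelModel.lintegral_state_one_lt_top [IsProbabilityMeasure P]
    (h : IsChannelModel P M Z) (d : Fin N → ℂ) :
    ∫⁻ x, ‖d ⬝ᵥ state A B π M Z 1 x‖ₑ ^ 2 ∂P < ⊤ := by
  have e (x : Ω) : d ⬝ᵥ state A B π M Z 1 x = (d ᵥ* A) ⬝ᵥ M x := by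
    have : (fun _ : Fin 1 => (0 : ℂ)) = 0 := rfl
    simp [state, this, dotProduct_mulVec]
  simp only [e]
  refine (lintegral_enorm_dotProduct_sq_le h.measurable_message _).trans_lt ?_
  exact ENNReal.mul_lt_top ENNReal.coe_lt_top
    (ENNReal.sum_lt_top.2 fun j _ => h.lintegral_message_lt_top j)

end Moments

/-! ### The exact cost identity. -/

section Cost

lemma conjTranspose_mul_self_zero_zero {n : Type*} [Fintype n] (u : Matrix n (Fin 1) ℂ) :
    (uᴴ * u) 0 0 = ((∑ k, ‖u k 0‖ ^ 2 : ℝ) : ℂ) := by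
  simp only [Matrix.mul_apply, conjTranspose_apply]
  push_cast
  exact Finset.sum_congr rfl fun k _ => Complex.conj_mul' _

/-- The variance `B' G B` contributed by the noise, for `G = L' L`. -/
noncomputable def noiseCost (L : Matrix (Fin N) (Fin N) ℂ) (B : Matrix (Fin N) (Fin 1) ℂ) : ℝ≥0 :=
  ∑ k, ‖L.row k ⬝ᵥ B.col 0‖₊ ^ 2

/-- `complete_square` with `G = L'L`: every quadratic form becomes a sum of squared norms, so the
identity lives in `ℝ≥0∞` and can be integrated without finiteness hypotheses. -/
lemma IsPosDefRiccatiSolution.energy_identity (h : IsPosDefRiccatiSolution A B G)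
    (hL : G = Lᴴ * L) (s : Fin N → ℂ) (x : ℂ) :
    ∑ k, ‖L.row k ⬝ᵥ (A *ᵥ s + B *ᵥ fun _ => x)‖ₑ ^ 2 + ‖x‖ₑ ^ 2 =
      ∑ k, ‖L.row k ⬝ᵥ s‖ₑ ^ 2 + (noiseCost L B + 1) * ‖x + (gain A B G *ᵥ s) 0‖ₑ ^ 2 := by
  let S : Matrix (Fin N) (Fin 1) ℂ := fun j _ => s j
  let X : Matrix (Fin 1) (Fin 1) ℂ := fun _ _ => x
  have h1 := h.complete_square S X
  generalize gain A B G = C at *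
  set e := x + (C *ᵥ s) 0 with he
  let E : Matrix (Fin 1) (Fin 1) ℂ := fun _ _ => e
  have hE : X + C * S = E := by
    ext i j
    rw [Subsingleton.elim i 0]
    rfl
  have h2 : (L * (A * S + B * X))ᴴ * (L * (A * S + B * X)) + Xᴴ * X =
      (L * S)ᴴ * (L * S) + ((L * B * E)ᴴ * (L * B * E) + Eᴴ * E) := by
    rw [hE, hL] at h1
    simp only [conjTranspose_mul, Matrix.mul_assoc, Matrix.mul_add, Matrix.add_mul,
      conjTranspose_add, Matrix.one_mul] at h1 ⊢
    exact h1
  have h3 := congrFun (congrFun h2 0) 0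
  simp only [Matrix.add_apply, conjTranspose_mul_self_zero_zero] at h3
  have h4 : ∑ k, ‖L.row k ⬝ᵥ (A *ᵥ s + B *ᵥ fun _ => x)‖ ^ 2 + ‖x‖ ^ 2 =
      ∑ k, ‖L.row k ⬝ᵥ s‖ ^ 2 + ((∑ k, ‖L.row k ⬝ᵥ B.col 0‖ ^ 2) * ‖e‖ ^ 2 + ‖e‖ ^ 2) := by
    have e1 (k) : (L * (A * S + B * X)) k 0 = L.row k ⬝ᵥ (A *ᵥ s + B *ᵥ fun _ => x) := rfl
    have e2 (k) : (L * S) k 0 = L.row k ⬝ᵥ s := rfl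
    have e3 (k) : (L * B * E) k 0 = (L.row k ⬝ᵥ B.col 0) * e := by
      rw [Matrix.mul_apply, Fin.sum_univ_one]
      rfl
    have e4 : X 0 0 = x := rfl
    have e5 : E 0 0 = e := rfl
    simp only [e1, e2, e3, e4, e5, Fin.sum_univ_one, norm_mul, mul_pow, ← Finset.sum_mul] at h3
    exact_mod_cast h3
  have h5 : ∑ k, ‖L.row k ⬝ᵥ (A *ᵥ s + B *ᵥ fun _ => x)‖₊ ^ 2 + ‖x‖₊ ^ 2 =
      ∑ k, ‖L.row k ⬝ᵥ s‖₊ ^ 2 + (noiseCost L B + 1) * ‖e‖₊ ^ 2 := by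
    rw [noiseCost, add_mul, one_mul]
    apply NNReal.coe_injective
    push_cast
    exact h4
  simp only [enorm_eq_nnnorm]
  exact_mod_cast h5

variable [MeasurableSpace Ω] {P : Measure Ω} [IsProbabilityMeasure P]

/-- The expected cost-to-go `E (S n)' G (S n)`, for `G = L' L`. -/
noncomputable def expectedEnergy (L : Matrix (Fin N) (Fin N) ℂ) (P : Measure Ω) (U : Ω → Fin N → ℂ) : ℝ≥0∞ :=
  ∑ k, ∫⁻ x, ‖L.row k ⬝ᵥ U x‖ₑ ^ 2 ∂P

/-- The noise `Z i` is independent of `S i` and of the action, so it only adds `B'GB` to the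
integrated `energy_identity`. -/
lemma IsPosDefRiccatiSolution.cost_step (h : IsPosDefRiccatiSolution A B G) (hL : G = Lᴴ * L)
    (hMZ : IsChannelModel P M Z) (hπ : ∀ i, Measurable (π i)) {i : ℕ} (hi : i ≠ 0) :
    expectedEnergy L P (state A B π M Z (i + 1)) + ∫⁻ x, ‖π i (state A B π M Z i x)‖ₑ ^ 2 ∂P =
      expectedEnergy L P (state A B π M Z i) + (noiseCost L B + 1) *
        ∫⁻ x, ‖π i (state A B π M Z i x) -
          linearController (gain A B G) i (state A B π M Z i x)‖ₑ ^ 2 ∂P + noiseCost L B := by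
  have hS := hMZ.measurable_state (A := A) (B := B) hπ i
  have hX : Measurable fun x => π i (state A B π M Z i x) := (hπ i).comp hS
  have hX2 : Measurable fun x => ‖π i (state A B π M Z i x)‖ₑ ^ 2 := by fun_prop
  have hT : Measurable fun x =>
      A *ᵥ state A B π M Z i x + B *ᵥ fun _ => π i (state A B π M Z i x) :=
    ((Continuous.matrix_mulVec continuous_const continuous_id).measurable.comp hS).add
      ((Continuous.matrix_mulVec continuous_const continuous_id).measurable.comp
        (measurable_pi_lambda _ fun _ => hX))
  have hC : Measurable fun s : Fin N → ℂ => (gain A B G *ᵥ s) 0 :=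
    (measurable_pi_apply 0).comp
      (Continuous.matrix_mulVec continuous_const continuous_id).measurable
  have hD : Measurable fun x => ‖π i (state A B π M Z i x) +
      (gain A B G *ᵥ state A B π M Z i x) 0‖ₑ ^ 2 := by
    have := hC.comp hS
    fun_prop
  have h1 := lintegral_congr (μ := P) fun x =>
    h.energy_identity hL (state A B π M Z i x) (π i (state A B π M Z i x))
  rw [lintegral_add_right _ hX2, lintegral_add_right _ (hD.const_mul _),
    lintegral_const_mul _ hD, lintegral_finsetSum _ fun k _ =>
      measurable_enorm_dotProduct_sq hT _, lintegral_finsetSum _ fun k _ =>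
      measurable_enorm_dotProduct_sq hS _] at h1
  have h2 : expectedEnergy L P (state A B π M Z (i + 1)) =
      ∑ k, ∫⁻ x, ‖L.row k ⬝ᵥ (A *ᵥ state A B π M Z i x +
        B *ᵥ fun _ => π i (state A B π M Z i x))‖ₑ ^ 2 ∂P + noiseCost L B := by
    rw [expectedEnergy, noiseCost, Finset.sum_congr rfl fun k _ =>
      hMZ.lintegral_dotProduct_state_succ hπ hi (L.row k), Finset.sum_add_distrib]
    simp [enorm_eq_nnnorm]
  rw [h2, add_right_comm, h1]
  simp only [linearController, sub_neg_eq_add, expectedEnergy]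

lemma IsPosDefRiccatiSolution.cost_sum (h : IsPosDefRiccatiSolution A B G) (hL : G = Lᴴ * L)
    (hMZ : IsChannelModel P M Z) (hπ : ∀ i, Measurable (π i)) (n : ℕ) :
    expectedEnergy L P (state A B π M Z (n + 1)) +
        ∑ i ∈ Finset.Icc 1 n, ∫⁻ x, ‖π i (state A B π M Z i x)‖ₑ ^ 2 ∂P =
      expectedEnergy L P (state A B π M Z 1) + (noiseCost L B + 1) *
        ∑ i ∈ Finset.Icc 1 n, ∫⁻ x, ‖π i (state A B π M Z i x) -
          linearController (gain A B G) i (state A B π M Z i x)‖ₑ ^ 2 ∂P + n * noiseCost L B := by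
  induction n with
  | zero => simp
  | succ n ih =>
    rw [Finset.sum_Icc_succ_top (by omega), Finset.sum_Icc_succ_top (by omega), mul_add,
      add_comm (Finset.sum _ _), ← add_assoc, h.cost_step hL hMZ hπ n.succ_ne_zero, add_right_comm,
      add_right_comm _ _ (Finset.sum _ _), ih]
    push_cast
    ring

end Cost

end LTIControl

namespace LTIControl

open Matrix

variable {N : ℕ} {Ω : Type*} {A G L : Matrix (Fin N) (Fin N) ℂ} {B : Matrix (Fin N) (Fin 1) ℂ}
  {π : Controller N} {M : Ω → Fin N → ℂ} {Z : ℕ → Ω → ℂ}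
  [MeasurableSpace Ω] {P : Measure Ω}

lemma Stabilizes.eventually_expectedEnergy_le (h : Stabilizes A B P M Z π)
    (hMZ : IsChannelModel P M Z) (hπ : ∀ i, Measurable (π i)) (L : Matrix (Fin N) (Fin N) ℂ) :
    ∃ K : ℝ≥0, ∀ᶠ n in atTop, expectedEnergy L P (state A B π M Z n) ≤ K := by
  choose K hK using fun k => eventually_lintegral_enorm_dotProduct_sq_le
    (fun n => hMZ.measurable_state (A := A) (B := B) hπ n) (stabilizes_iff.1 h) (L.row k)
  refine ⟨∑ k, K k, ?_⟩
  filter_upwards [eventually_all.2 hK] with n hn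
  push_cast
  exact Finset.sum_le_sum fun k _ => hn k

variable [IsProbabilityMeasure P]

/-! ### Linear controllers: impulse response, controllability, stability. -/

section LinearControllers

variable {K : Matrix (Fin 1) (Fin N) ℂ}

lemma linearController_mem_separatedControllers :
    linearController K ∈ separatedControllers N := by
  refine ⟨fun _ j z => -(K 0 j * z), fun _ _ => by fun_prop, fun i s => ?_⟩
  simp [linearController, Matrix.mulVec, dotProduct]

lemma separatedControllers_subset : separatedControllers N ⊆ fullStateControllers N := by
  rintro π ⟨p, hp, h⟩ i
  rw [funext (h i)]
  exact Finset.measurable_sum _ fun j _ => (hp i j).comp (measurable_pi_apply j)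

lemma measurable_linearController (i : ℕ) : Measurable (linearController K i) :=
  separatedControllers_subset linearController_mem_separatedControllers i

/-- Moves one closed-loop step from the state onto the functional `d`, so that it can be iterated.
-/
lemma IsChannelModel.lintegral_dotProduct_state_succ_linear (h : IsChannelModel P M Z) {i : ℕ}
    (hi : i ≠ 0) (d : Fin N → ℂ) :
    ∫⁻ x, ‖d ⬝ᵥ state A B (linearController K) M Z (i + 1) x‖ₑ ^ 2 ∂P =
      ∫⁻ x, ‖(d ᵥ* (A - B * K)) ⬝ᵥ state A B (linearController K) M Z i x‖ₑ ^ 2 ∂P +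
        ‖d ⬝ᵥ B.col 0‖ₑ ^ 2 := by
  rw [h.lintegral_dotProduct_state_succ measurable_linearController hi]
  congr 1
  refine lintegral_congr fun x => ?_
  generalize state A B (linearController K) M Z i x = s
  have : (fun _ : Fin 1 => linearController K i s) = -(K *ᵥ s) := by
    ext j
    rw [Subsingleton.elim j 0]
    rfl
  rw [this, ← dotProduct_mulVec, sub_mulVec, mulVec_neg, ← sub_eq_add_neg, mulVec_mulVec]

/-- The closed-loop impulse response bounds the second moments of the state from below. -/
lemma IsChannelModel.enorm_impulseResponse_sq_le (h : IsChannelModel P M Z) (m : ℕ)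
    (d : Fin N → ℂ) {i : ℕ} (hi : m + 2 ≤ i) :
    ‖(d ᵥ* (A - B * K) ^ m) ⬝ᵥ B.col 0‖ₑ ^ 2 ≤
      ∫⁻ x, ‖d ⬝ᵥ state A B (linearController K) M Z i x‖ₑ ^ 2 ∂P := by
  -- The response at lag `m` comes from the noise `Z (i - 1 - m)`, which enters only at times at
  -- least one; hence `m + 2 ≤ i`.
  induction m generalizing d i with
  | zero =>
    obtain ⟨i, rfl⟩ : ∃ j, i = j + 1 := ⟨i - 1, by omega⟩
    rw [h.lintegral_dotProduct_state_succ_linear (by omega), pow_zero, vecMul_one]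
    exact le_add_self
  | succ m ih =>
    obtain ⟨i, rfl⟩ : ∃ j, i = j + 1 := ⟨i - 1, by omega⟩
    rw [h.lintegral_dotProduct_state_succ_linear (by omega),
      pow_succ' (A - B * K), ← vecMul_vecMul]
    exact (ih _ (by omega)).trans le_self_add

/-- A linear functional orthogonal to the closed-loop controllable subspace is orthogonal to the
open-loop one. -/
lemma vecMul_pow_dotProduct_eq_zero {d : Fin N → ℂ} {b : Fin N → ℂ} {k : Fin N → ℂ}
    (h : ∀ m, (d ᵥ* (A - vecMulVec b k) ^ m) ⬝ᵥ b = 0) (m : ℕ) : (d ᵥ* A ^ m) ⬝ᵥ b = 0 := by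
  set F := A - vecMulVec b k with hF
  have hA : A = F + vecMulVec b k := by rw [hF, sub_add_cancel]
  -- Strengthened to all `F ^ q *ᵥ b` for the induction: `A F^q b` is `F^(q+1) b` plus a multiple of
  -- `b`, and `ih 0` kills the latter.
  have key (p q : ℕ) : (d ᵥ* A ^ p) ⬝ᵥ ((F ^ q) *ᵥ b) = 0 := by
    induction p generalizing q with
    | zero => rw [pow_zero, vecMul_one, dotProduct_mulVec, h]
    | succ p ih =>
      have h0 := ih 0
      rw [pow_zero, one_mulVec] at h0
      rw [pow_succ, ← vecMul_vecMul, ← dotProduct_mulVec]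
      nth_rewrite 2 [hA]
      rw [add_mulVec, dotProduct_add, mulVec_mulVec, ← pow_succ', ih, zero_add,
        vecMulVec_mulVec, op_smul_eq_smul, dotProduct_smul, h0, smul_zero]
  simpa using key m 0

lemma eq_zero_of_vecMul_diagonal_pow {a d : Fin N → ℂ} (ha : Function.Injective a)
    (h : ∀ m : ℕ, (d ᵥ* diagonal a ^ m) ⬝ᵥ (inputMatrix N).col 0 = 0) : d = 0 := by
  refine eq_zero_of_forall_pow_sum_mul_pow_eq_zero ha fun i => ?_
  rw [← h i, diagonal_pow]
  simp [dotProduct, vecMul_diagonal, inputMatrix]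

/-- The optimal linear controller contracts the modes of `G * S`. -/
lemma IsPosDefRiccatiSolution.stabilizes {a : Fin N → ℂ} (ha : ∀ j, 1 < ‖a j‖)
    (h : IsPosDefRiccatiSolution (diagonal a) B G) (hMZ : IsChannelModel P M Z) :
    Stabilizes (diagonal a) B P M Z (linearController (gain (diagonal a) B G)) := by
  have hF := riccati_iff.1 h.2
  set C := gain (diagonal a) B G
  set S := state (diagonal a) B (linearController C) M Z
  have hS (i) : Measurable (S i) := hMZ.measurable_state measurable_linearController i
  have ha0 (j) : a j ≠ 0 := fun h0 => by
    have := ha j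
    rw [h0, norm_zero] at this
    linarith
  -- Row `k` of `A' G F = G`, the adjoint `A'` being diagonal.
  have hrow (k : Fin N) : G.row k ᵥ* (diagonal a - B * C) = (star (a k))⁻¹ • G.row k := by
    have hk : star (a k) ≠ 0 := star_ne_zero.2 (ha0 k)
    ext j
    have := congrFun (congrFun hF k) j
    rw [Matrix.mul_assoc, diagonal_conjTranspose, diagonal_mul] at this
    simp only [Pi.smul_apply, smul_eq_mul, row_apply]
    rw [eq_inv_mul_iff_mul_eq₀ hk]
    exact this
  have hbound (k : Fin N) : ∃ R : ℝ≥0, ∀ᶠ n in atTop, ∫⁻ x, ‖(G *ᵥ S n x) k‖ₑ ^ 2 ∂P ≤ R := by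
    have h1 : ∫⁻ x, ‖G.row k ⬝ᵥ S 1 x‖ₑ ^ 2 ∂P < ⊤ := hMZ.lintegral_state_one_lt_top _
    obtain ⟨T, hT⟩ : ∃ T : ℝ≥0, (T : ℝ≥0∞) = _ := ⟨_, ENNReal.coe_toNNReal h1.ne⟩
    set r : ℝ≥0 := ‖(star (a k))⁻¹‖₊ ^ 2
    have hr : r < 1 := by
      refine pow_lt_one₀ zero_le ?_ two_ne_zero
      rw [nnnorm_inv]
      refine inv_lt_one_of_one_lt₀ ?_
      rw [← NNReal.coe_lt_coe, coe_nnnorm, norm_star]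
      exact ha k
    set c : ℝ≥0 := ‖G.row k ⬝ᵥ B.col 0‖₊ ^ 2
    -- `c / (1 - r)` is the fixed point of `t ↦ r t + c`; adding the initial value `T` gives a bound
    -- preserved by the recursion.
    have hR : r * (T + c / (1 - r)) + c ≤ T + c / (1 - r) := by
      have h2 : (1 - r) ≠ 0 := (tsub_pos_of_lt hr).ne'
      have h3 : (1 - r) + r = 1 := tsub_add_cancel_of_le hr.le
      calc r * (T + c / (1 - r)) + c
          = r * T + (r * (c / (1 - r)) + (1 - r) * (c / (1 - r))) := by
            rw [mul_div_cancel₀ _ h2]; ring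
        _ = r * T + c / (1 - r) := by rw [← add_mul, add_comm r, h3, one_mul]
        _ ≤ T + c / (1 - r) := by
            gcongr
            exact mul_le_of_le_one_left zero_le hr.le
    refine ⟨T + c / (1 - r), eventually_atTop.2 ⟨1, fun n hn => ?_⟩⟩
    change ∫⁻ x, ‖G.row k ⬝ᵥ S n x‖ₑ ^ 2 ∂P ≤ _
    induction n, hn using Nat.le_induction with
    | base =>
      rw [← hT]
      exact_mod_cast le_self_add
    | succ n hn ih =>
      rw [hMZ.lintegral_dotProduct_state_succ_linear (by omega), hrow]
      have e (x : Ω) : ‖((star (a k))⁻¹ • G.row k) ⬝ᵥ S n x‖ₑ ^ 2 =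
          (r : ℝ≥0∞) * ‖G.row k ⬝ᵥ S n x‖ₑ ^ 2 := by
        rw [smul_dotProduct, smul_eq_mul, enorm_mul, mul_pow]
        simp only [r, enorm_eq_nnnorm, ENNReal.coe_pow]
      change ∫⁻ x, ‖((star (a k))⁻¹ • G.row k) ⬝ᵥ S n x‖ₑ ^ 2 ∂P + _ ≤ _
      rw [lintegral_congr e, lintegral_const_mul _ (measurable_enorm_dotProduct_sq (hS n) _)]
      have hc : ‖G.row k ⬝ᵥ B.col 0‖ₑ ^ 2 = (c : ℝ≥0∞) := by simp [c, enorm_eq_nnnorm]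
      rw [hc]
      calc (r : ℝ≥0∞) * ∫⁻ x, ‖G.row k ⬝ᵥ S n x‖ₑ ^ 2 ∂P + c
          ≤ r * ((T + c / (1 - r) : ℝ≥0) : ℝ≥0∞) + c := by gcongr
        _ ≤ _ := by exact_mod_cast hR
  refine stabilizes_iff.2 fun j => ?_
  obtain ⟨R, hR⟩ := eventually_lintegral_enorm_dotProduct_sq_le
    (fun n => (Continuous.matrix_mulVec continuous_const continuous_id).measurable.comp (hS n))
    hbound (G⁻¹.row j)
  refine ⟨R, hR.mono fun n hn => le_of_eq_of_le (lintegral_congr fun x => ?_) hn⟩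
  have : S n x = G⁻¹ *ᵥ (G *ᵥ S n x) := by
    rw [mulVec_mulVec, nonsing_inv_mul _ ((isUnit_iff_isUnit_det _).1 h.1.isUnit), one_mulVec]
  exact congrArg (‖·‖ₑ ^ 2) (congrFun this j)

end LinearControllers

/-! ### Optimality and uniqueness. -/

section Optimality

lemma tendsto_const_div_natCast (K : ℝ≥0) :
    Tendsto (fun n : ℕ => (K : ℝ≥0∞) / n) atTop (𝓝 0) := by
  have := ENNReal.Tendsto.const_div (a := (K : ℝ≥0∞)) ENNReal.tendsto_nat_nhds_top
    (Or.inr ENNReal.coe_ne_top)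
  simpa using this

lemma IsPosDefRiccatiSolution.eventually_le_averagePower (h : IsPosDefRiccatiSolution A B G)
    (hL : G = Lᴴ * L) (hMZ : IsChannelModel P M Z) (hπ : ∀ i, Measurable (π i))
    (hs : Stabilizes A B P M Z π) :
    ∃ K : ℝ≥0, ∀ᶠ n : ℕ in atTop, (noiseCost L B : ℝ≥0∞) +
      averageDeviation A B P M Z π (linearController (gain A B G)) n ≤
        (K : ℝ≥0∞) / n + averagePower A B P M Z π n := by
  obtain ⟨K, hK⟩ := hs.eventually_expectedEnergy_le hMZ hπ L
  refine ⟨K, ?_⟩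
  filter_upwards [(tendsto_add_atTop_nat 1).eventually hK, eventually_ge_atTop 1] with n hn h1
  have hn0 : (n : ℝ≥0∞) ≠ 0 := by exact_mod_cast (by omega : n ≠ 0)
  have hsum := h.cost_sum hL hMZ hπ n
  rw [averageDeviation, averagePower, ← ENNReal.add_div]
  set D := ∑ i ∈ Finset.Icc 1 n, ∫⁻ x, ‖π i (state A B π M Z i x) -
          linearController (gain A B G) i (state A B π M Z i x)‖ₑ ^ 2 ∂P
  have e : (noiseCost L B : ℝ≥0∞) + D / n = (D + n * noiseCost L B) / n := by
    rw [ENNReal.add_div, ENNReal.mul_div_right_comm, ENNReal.div_self hn0 (by simp), one_mul,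
      add_comm]
  rw [e]
  gcongr ?_ / _
  -- The coefficient `B'GB + 1` of the deviation is only used through being at least one.
  calc D + n * noiseCost L B
      ≤ expectedEnergy L P (state A B π M Z 1) + (noiseCost L B + 1) * D + n * noiseCost L B := by
        gcongr
        calc D = 1 * D := (one_mul D).symm
          _ ≤ (noiseCost L B + 1) * D := by gcongr; exact le_add_self
          _ ≤ _ := le_add_self
    _ ≤ _ := by
        rw [← hsum]
        gcongr

lemma IsPosDefRiccatiSolution.le_liminf_averagePower (h : IsPosDefRiccatiSolution A B G)
    (hL : G = Lᴴ * L) (hMZ : IsChannelModel P M Z) (hπ : ∀ i, Measurable (π i))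
    (hs : Stabilizes A B P M Z π) :
    (noiseCost L B : ℝ≥0∞) ≤ liminf (averagePower A B P M Z π) atTop := by
  obtain ⟨K, hK⟩ := h.eventually_le_averagePower hL hMZ hπ hs
  have ht : Tendsto (fun n : ℕ => (noiseCost L B : ℝ≥0∞) - (K : ℝ≥0∞) / n) atTop
      (𝓝 (noiseCost L B)) := by
    have := ENNReal.Tendsto.sub (tendsto_const_nhds (x := (noiseCost L B : ℝ≥0∞)))
      (tendsto_const_div_natCast K) (Or.inl ENNReal.coe_ne_top)
    simpa using this
  rw [← ht.liminf_eq]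
  refine liminf_le_liminf (hK.mono fun n hn => ?_)
  exact tsub_le_iff_left.2 (le_self_add.trans hn)

/-- With zero deviation, dropping the terminal energy in `cost_sum` gives the matching upper bound
`V 1 / n + B'GB`. -/
lemma IsPosDefRiccatiSolution.tendsto_averagePower (h : IsPosDefRiccatiSolution A B G)
    (hL : G = Lᴴ * L) (hMZ : IsChannelModel P M Z)
    (hs : Stabilizes A B P M Z (linearController (gain A B G))) :
    Tendsto (averagePower A B P M Z (linearController (gain A B G))) atTop
      (𝓝 (noiseCost L B)) := by
  have hfin : expectedEnergy L P (state A B (linearController (gain A B G)) M Z 1) < ⊤ :=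
    ENNReal.sum_lt_top.2 fun k _ => hMZ.lintegral_state_one_lt_top _
  obtain ⟨T, hT⟩ : ∃ T : ℝ≥0, (T : ℝ≥0∞) = _ := ⟨_, ENNReal.coe_toNNReal hfin.ne⟩
  have hup : ∀ᶠ n : ℕ in atTop, averagePower A B P M Z (linearController (gain A B G)) n ≤
      (T : ℝ≥0∞) / n + noiseCost L B := by
    filter_upwards [eventually_ge_atTop 1] with n h1
    have hn0 : (n : ℝ≥0∞) ≠ 0 := by exact_mod_cast (by omega : n ≠ 0)
    have hsum := h.cost_sum hL hMZ (measurable_linearController (K := gain A B G)) n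
    simp only [sub_self, enorm_zero, ne_eq, OfNat.ofNat_ne_zero, not_false_eq_true, zero_pow,
      lintegral_zero, Finset.sum_const_zero, mul_zero, add_zero, ← hT] at hsum
    have e : (T : ℝ≥0∞) / n + noiseCost L B = (T + n * noiseCost L B) / n := by
      rw [ENNReal.add_div, ENNReal.mul_div_right_comm, ENNReal.div_self hn0 (by simp), one_mul]
    rw [averagePower, e, ← hsum]
    gcongr
    exact le_add_self
  have ht := (tendsto_const_div_natCast T).add_const (noiseCost L B : ℝ≥0∞)
  rw [zero_add] at ht
  refine tendsto_of_le_liminf_of_limsup_le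
    (h.le_liminf_averagePower hL hMZ measurable_linearController hs) ?_
  rw [← ht.limsup_eq]
  exact limsup_le_limsup hup

variable {𝒞 : Set (Controller N)}

lemma IsPosDefRiccatiSolution.isOptimal (h : IsPosDefRiccatiSolution A B G)
    (hL : G = Lᴴ * L) (hMZ : IsChannelModel P M Z) (h𝒞 : 𝒞 ⊆ fullStateControllers N)
    (hmem : linearController (gain A B G) ∈ 𝒞)
    (hs : Stabilizes A B P M Z (linearController (gain A B G))) :
    IsOptimal A B P M Z 𝒞 (linearController (gain A B G)) :=
  ⟨hmem, hs, noiseCost L B, h.tendsto_averagePower hL hMZ hs,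
    fun _ hσ hσs => h.le_liminf_averagePower hL hMZ (h𝒞 hσ) hσs⟩

lemma IsPosDefRiccatiSolution.tendsto_averageDeviation (h : IsPosDefRiccatiSolution A B G)
    (hL : G = Lᴴ * L) (hMZ : IsChannelModel P M Z) (h𝒞 : 𝒞 ⊆ fullStateControllers N)
    (hmem : linearController (gain A B G) ∈ 𝒞)
    (hs : Stabilizes A B P M Z (linearController (gain A B G)))
    (hπ : IsOptimal A B P M Z 𝒞 π) :
    Tendsto (averageDeviation A B P M Z π (linearController (gain A B G))) atTop (𝓝 0) := by
  obtain ⟨hπ𝒞, hπs, p, hp, hopt⟩ := hπ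
  -- Comparison with `-C S` as competitor; it makes the truncated difference `p - noiseCost L B`
  -- zero, which squeezes the deviation.
  have hle : (p : ℝ≥0∞) ≤ noiseCost L B :=
    (hopt _ hmem hs).trans_eq (h.tendsto_averagePower hL hMZ hs).liminf_eq
  obtain ⟨K, hK⟩ := h.eventually_le_averagePower hL hMZ (h𝒞 hπ𝒞) hπs
  have ht : Tendsto (fun n : ℕ => (K : ℝ≥0∞) / n + averagePower A B P M Z π n -
      (noiseCost L B : ℝ≥0∞)) atTop (𝓝 0) := by
    have := ENNReal.Tendsto.sub ((tendsto_const_div_natCast K).add hp)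
      (tendsto_const_nhds (x := (noiseCost L B : ℝ≥0∞))) (Or.inr ENNReal.coe_ne_top)
    rwa [zero_add, tsub_eq_zero_of_le hle] at this
  refine tendsto_of_tendsto_of_tendsto_of_le_of_le' tendsto_const_nhds ht
    (Eventually.of_forall fun _ => zero_le) (hK.mono fun n hn => ?_)
  exact ENNReal.le_sub_of_add_le_left ENNReal.coe_ne_top hn

/-- If the averages of a sequence tend to zero, so does every eventual lower bound. -/
lemma eq_zero_of_tendsto_average {u : ℕ → ℝ≥0∞} {v : ℝ≥0∞} {m : ℕ} (hv : ∀ i, m + 1 ≤ i → v ≤ u i)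
    (h : Tendsto (fun n : ℕ => (∑ i ∈ Finset.Icc 1 n, u i) / n) atTop (𝓝 0)) : v = 0 := by
  -- For `n > 2 m` at least half of the indices up to `n` exceed `m`, so the averages are at least
  -- `v / 2`.
  have h2 : v / 2 ≤ 0 := by
    refine ge_of_tendsto h ?_
    filter_upwards [eventually_ge_atTop (2 * m + 1)] with n hn
    have hn0 : (n : ℝ≥0∞) ≠ 0 := by exact_mod_cast (by omega : n ≠ 0)
    rw [ENNReal.le_div_iff_mul_le (Or.inl hn0) (Or.inl (by simp))]
    have hnm : (n : ℝ≥0∞) ≤ 2 * ((n - m : ℕ) : ℝ≥0∞) := by exact_mod_cast (by omega)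
    calc v / 2 * n ≤ v / 2 * (2 * ((n - m : ℕ) : ℝ≥0∞)) := by gcongr
      _ = ((n - m : ℕ) : ℝ≥0∞) * v := by
          rw [← mul_assoc, ENNReal.div_mul_cancel (by simp) (by simp), mul_comm]
      _ = ∑ _i ∈ Finset.Icc (m + 1) n, v := by simp
      _ ≤ ∑ i ∈ Finset.Icc (m + 1) n, u i :=
          Finset.sum_le_sum fun i hi => hv i (Finset.mem_Icc.1 hi).1
      _ ≤ ∑ i ∈ Finset.Icc 1 n, u i :=
          Finset.sum_le_sum_of_subset (Finset.Icc_subset_Icc (by omega) le_rfl)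
  simpa using h2

/-- Two linear gains whose actions agree on average along the trajectory of the first are equal. -/
lemma eq_of_tendsto_averageDeviation {a : Fin N → ℂ} (ha : Function.Injective a)
    (hMZ : IsChannelModel P M Z) {K C : Matrix (Fin 1) (Fin N) ℂ}
    (h : Tendsto (averageDeviation (diagonal a) (inputMatrix N) P M Z (linearController K)
      (linearController C)) atTop (𝓝 0)) : K = C := by
  set d := (C - K).row 0 with hd
  have e (i : ℕ) (s : Fin N → ℂ) :
      linearController K i s - linearController C i s = d ⬝ᵥ s := by
    have : d ⬝ᵥ s = ((C - K) *ᵥ s) 0 := rfl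
    rw [this, sub_mulVec, Pi.sub_apply, linearController, linearController]
    ring
  have hBK : inputMatrix N * K = vecMulVec ((inputMatrix N).col 0) (K.row 0) := by
    ext i j
    simp [Matrix.mul_apply, vecMulVec_apply]
  have hd0 : d = 0 := by
    refine eq_zero_of_vecMul_diagonal_pow ha
      (vecMul_pow_dotProduct_eq_zero (k := K.row 0) fun m => ?_)
    rw [← hBK]
    unfold averageDeviation at h
    simp only [e] at h
    have := eq_zero_of_tendsto_average (m := m + 1)
      (fun i hi => hMZ.enorm_impulseResponse_sq_le (A := diagonal a) (B := inputMatrix N) (K := K)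
        m d hi) h
    simpa using this
  have hCK : C - K = 0 := by
    ext i j
    rw [Subsingleton.elim i 0]
    exact congrFun hd0 j
  exact (sub_eq_zero.1 hCK).symm

end Optimality

open scoped MatrixOrder in
lemma exists_eq_conjTranspose_mul_self (hG : G.PosSemidef) :
    ∃ L : Matrix (Fin N) (Fin N) ℂ, G = Lᴴ * L :=
  CStarAlgebra.nonneg_iff_eq_star_mul_self.1 hG.nonneg

end LTIControl

theorem mainTheorem12 {N : ℕ} (hN : 1 ≤ N) (β : Fin N → ℝ) (w : Fin N → ℂ)
    (hβ : ∀ j, 1 < β j) (hw : ∀ j, ‖w j‖ = 1) (hw_inj : Function.Injective w)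
    {Ω : Type*} [MeasurableSpace Ω] (P : Measure Ω) [IsProbabilityMeasure P]
    (M : Ω → Fin N → ℂ) (Z : ℕ → Ω → ℂ) (hMZ : LTIControl.IsChannelModel P M Z)
    (A : Matrix (Fin N) (Fin N) ℂ) (hA : A = LTIControl.systemMatrix β w)
    (B : Matrix (Fin N) (Fin 1) ℂ) (hB : B = LTIControl.inputMatrix N) :
    (∃! G, LTIControl.IsPosDefRiccatiSolution A B G) ∧
    ∀ G, LTIControl.IsPosDefRiccatiSolution A B G →
      LTIControl.IsOptimal A B P M Z (LTIControl.separatedControllers N)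
        (LTIControl.linearController (LTIControl.gain A B G)) ∧
      LTIControl.IsOptimal A B P M Z (LTIControl.fullStateControllers N)
        (LTIControl.linearController (LTIControl.gain A B G)) ∧
      (∀ K : Matrix (Fin 1) (Fin N) ℂ,
        LTIControl.IsOptimal A B P M Z (LTIControl.separatedControllers N)
          (LTIControl.linearController K) → K = LTIControl.gain A B G) ∧
      (∀ π : LTIControl.Controller N,
        LTIControl.IsOptimal A B P M Z (LTIControl.separatedControllers N) π →
          Tendsto (LTIControl.averageDeviation A B P M Z π
            (LTIControl.linearController (LTIControl.gain A B G))) atTop (𝓝 0)) := by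
  subst hB
  set a : Fin N → ℂ := fun j => (β j : ℂ) * w j with ha_def
  have hA' : A = Matrix.diagonal a := hA
  subst hA'
  have hnorm (j : Fin N) : ‖a j‖ = β j := by
    rw [ha_def, norm_mul, hw, mul_one, Complex.norm_real, Real.norm_of_nonneg (by linarith [hβ j])]
  have ha (j : Fin N) : 1 < ‖a j‖ := by rw [hnorm]; exact hβ j
  have hinj : Function.Injective a := by
    intro i j hij
    -- Entries `a j` may share a modulus or a phase; equality of both is excluded by reading `β` off
    -- the norm.
    have hβij : β i = β j := by rw [← hnorm, ← hnorm, hij]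
    have hβ0 : (β j : ℂ) ≠ 0 := by
      rw [Complex.ofReal_ne_zero]
      linarith [hβ j]
    refine hw_inj (mul_left_cancel₀ hβ0 ?_)
    simpa only [ha_def, hβij] using hij
  refine ⟨LTIControl.existsUnique_isPosDefRiccatiSolution ha hinj, fun G hG => ?_⟩
  obtain ⟨L, hL⟩ := LTIControl.exists_eq_conjTranspose_mul_self hG.1.posSemidef
  have hs := hG.stabilizes ha hMZ
  have hmem := LTIControl.linearController_mem_separatedControllers
    (K := LTIControl.gain (Matrix.diagonal a) (LTIControl.inputMatrix N) G)
  have hsub := LTIControl.separatedControllers_subset (N := N)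
  have hdev (π : LTIControl.Controller N) (hπ : LTIControl.IsOptimal _ _ P M Z _ π) :=
    hG.tendsto_averageDeviation hL hMZ hsub hmem hs hπ
  exact ⟨hG.isOptimal hL hMZ hsub hmem hs, hG.isOptimal hL hMZ le_rfl (hsub hmem) hs,
    fun K hK => LTIControl.eq_of_tendsto_averageDeviation hinj hMZ (hdev _ hK), hdev⟩
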